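/- Let $V:\mathbb{Z}\to\mathbb{R}$ be bounded, let $H$ be the bounded self-adjoint operator $[H\psi](n)=\psi(n+1)+\psi(n-1)+V(n)\psi(n)$ in $\ell^2(\mathbb{Z})$ (complex-valued), and let $E=\max\sigma(H)$. A solution $u:\mathbb{Z}\to\mathbb{C}$ of the difference equation $$u(n+1)+u(n-1)+V(n)u(n)=E\,u(n)\qquad(n\in\mathbb{Z})$$ is called subordinate at $+\infty$ if it does not vanish identically and $$\lim_{N\to\infty}\frac{\sum_{n=1}^N|u(n)|^2}{\sum_{n=1}^N|\tilde u(n)|^2}=0$$ for every solution $\tilde u:\mathbb{Z}\to\mathbb{C}$ that is not a multiple of $u$. It is called subordinate at $-\infty$ if the same holds with $u(-n)$ and $\tilde u(-n)$ in place of $u(n)$ and $\tilde u(n)$ in the two sums. If $u$ is a solution that is subordinate at $+\infty$, then there is a constant $c\in\mathbb{C}\setminus\{0\}$ such that $c\,u(n)$ is real and $c\,u(n)>0$ for every $n\in\mathbb{Z}$. The same conclusion holds for every solution that is subordinate at $-\infty$. -/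

import Mathlib

open Filter Topology
open scoped ENNReal

noncomputable section

namespace Schrodinger

/-- The complex Hilbert space `ℓ²(ℤ)`. -/
abbrev EllTwo : Type := lp (fun _ : ℤ => ℂ) 2

theorem memℓp_shift (ψ : EllTwo) (k : ℤ) : Memℓp (fun n : ℤ => ψ (n + k)) 2 := by
  have h := (lp.memℓp ψ).summable (by norm_num)
  exact memℓp_gen ((Equiv.addRight k).summable_iff.mpr h)

/-- The shift `ψ ↦ ψ (· + k)` on `ℓ²(ℤ)`. -/
def shift (k : ℤ) : EllTwo →L[ℂ] EllTwo :=
  LinearMap.mkContinuous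
    { toFun := fun ψ => ⟨fun n => ψ (n + k), memℓp_shift ψ k⟩
      map_add' := fun _ _ => rfl
      map_smul' := fun _ _ => rfl } 1 (by
    intro ψ
    rw [one_mul]
    refine lp.norm_le_of_tsum_le (p := 2) (by norm_num) (norm_nonneg _) ?_
    rw [lp.norm_rpow_eq_tsum (by norm_num) ψ]
    exact ((Equiv.addRight k).tsum_eq (fun n => ‖ψ n‖ ^ (2 : ℝ≥0∞).toReal)).le)

theorem memℓp_potential (V : ℤ → ℝ) (hV : ∃ C : ℝ, ∀ n, |V n| ≤ C) (ψ : EllTwo) :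
    Memℓp (fun n : ℤ => (V n : ℂ) * ψ n) 2 := by
  obtain ⟨C, hC⟩ := hV
  refine ((lp.memℓp ψ).const_smul (C : ℂ)).mono' (fun n => ?_)
  simp only [norm_mul, Complex.norm_real, Pi.smul_apply, smul_eq_mul, Real.norm_eq_abs]
  exact mul_le_mul_of_nonneg_right ((hC n).trans (le_abs_self C)) (norm_nonneg _)

/-- Multiplication by a bounded real potential `V` on `ℓ²(ℤ)`. -/
def potential (V : ℤ → ℝ) (hV : ∃ C : ℝ, ∀ n, |V n| ≤ C) : EllTwo →L[ℂ] EllTwo :=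
  LinearMap.mkContinuousOfExistsBound
    { toFun := fun ψ => ⟨fun n => (V n : ℂ) * ψ n, memℓp_potential V hV ψ⟩
      map_add' := fun ψ φ => by
        ext n
        exact mul_add _ _ _
      map_smul' := fun c ψ => by
        ext n
        exact mul_left_comm _ _ _ } (by
    obtain ⟨C, hC⟩ := hV
    refine ⟨‖(C : ℂ)‖, fun ψ => ?_⟩
    rw [← lp.norm_const_smul (by norm_num)]
    refine lp.norm_mono (by norm_num) (fun n => ?_)
    simp only [LinearMap.coe_mk, AddHom.coe_mk, norm_mul, Complex.norm_real, lp.coeFn_smul,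
      Pi.smul_apply, smul_eq_mul, Real.norm_eq_abs]
    exact mul_le_mul_of_nonneg_right ((hC n).trans (le_abs_self C)) (norm_nonneg _))

/-- The discrete Schrödinger operator `[H ψ](n) = ψ(n+1) + ψ(n-1) + V(n) ψ(n)` in `ℓ²(ℤ)`
with bounded potential `V : ℤ → ℝ`. -/
def hamiltonian (V : ℤ → ℝ) (hV : ∃ C : ℝ, ∀ n, |V n| ≤ C) : EllTwo →L[ℂ] EllTwo :=
  shift 1 + shift (-1) + potential V hV

theorem hamiltonian_apply (V : ℤ → ℝ) (hV : ∃ C : ℝ, ∀ n, |V n| ≤ C) (ψ : EllTwo) (n : ℤ) :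
    hamiltonian V hV ψ n = ψ (n + 1) + ψ (n - 1) + (V n : ℂ) * ψ n := rfl

/-- `E = max σ(H)`: the real number `E` is the largest element of the spectrum of `H`
(which, `H` being self-adjoint, is contained in `ℝ`). -/
def IsGroundStateEnergy (V : ℤ → ℝ) (hV : ∃ C : ℝ, ∀ n, |V n| ≤ C) (E : ℝ) : Prop :=
  IsGreatest {x : ℝ | (x : ℂ) ∈ spectrum ℂ (hamiltonian V hV)} E

/-- `u` solves the difference equation `u(n+1) + u(n-1) + V(n) u(n) = E u(n)` on `ℤ`. -/
def IsSolution (V : ℤ → ℝ) (E : ℝ) (u : ℤ → ℂ) : Prop :=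
  ∀ n : ℤ, u (n + 1) + u (n - 1) + (V n : ℂ) * u n = (E : ℂ) * u n

/-- `u` is a solution that is subordinate at `+∞`. -/
def IsSubordinateAtTop (V : ℤ → ℝ) (E : ℝ) (u : ℤ → ℂ) : Prop :=
  IsSolution V E u ∧ u ≠ 0 ∧
    ∀ v : ℤ → ℂ, IsSolution V E v → (¬ ∃ c : ℂ, v = c • u) →
      Tendsto (fun N : ℕ => (∑ n ∈ Finset.Icc 1 N, ‖u (n : ℤ)‖ ^ 2) /
        (∑ n ∈ Finset.Icc 1 N, ‖v (n : ℤ)‖ ^ 2)) atTop (𝓝 0)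

/-- `u` is a solution that is subordinate at `-∞`. -/
def IsSubordinateAtBot (V : ℤ → ℝ) (E : ℝ) (u : ℤ → ℂ) : Prop :=
  IsSolution V E u ∧ u ≠ 0 ∧
    ∀ v : ℤ → ℂ, IsSolution V E v → (¬ ∃ c : ℂ, v = c • u) →
      Tendsto (fun N : ℕ => (∑ n ∈ Finset.Icc 1 N, ‖u (-(n : ℤ))‖ ^ 2) /
        (∑ n ∈ Finset.Icc 1 N, ‖v (-(n : ℤ))‖ ^ 2)) atTop (𝓝 0)

/-- Up to a (nonzero) multiplicative constant, `u` is strictly positive at every site. -/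
def PositiveUpToConstant (u : ℤ → ℂ) : Prop :=
  ∃ c : ℂ, c ≠ 0 ∧ ∀ n : ℤ, ∃ r : ℝ, 0 < r ∧ c * u n = (r : ℂ)

end Schrodinger

end

open Filter Topology
open scoped ENNReal InnerProductSpace

/-! Since `E` tops the spectrum, the form of `E - H` is nonnegative. This keeps every solution with
a zero at a site positive to the right of it (`dirichletSolution_pos`); pushing that site to `-∞`
and using compactness gives a solution `p > 0` on all of `ℤ` (`exists_pos_solution`). Suppose `u` is
subordinate at `+∞` and not proportional to `p`. The Wronskian `W` of `u` and `p` is a nonzero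
constant, and `g = u / (W p)` grows by `1 / (p n * p (n + 1)) > 0` at each step. Subordinacy against
`p` forbids a positive lower bound for `‖g‖` near `+∞`, so `g` is real and negative throughout, and
`u = W g p` has the claimed form. Reflection handles `-∞`. -/

theorem IsSelfAdjoint.re_inner_le_of_spectrum_le {F : Type*} [NormedAddCommGroup F]
    [InnerProductSpace ℂ F] [CompleteSpace F] {T : F →L[ℂ] F} (hT : IsSelfAdjoint T) {E : ℝ}
    (hE : ∀ r : ℝ, (r : ℂ) ∈ spectrum ℂ T → r ≤ E) (x : F) :
    (⟪T x, x⟫_ℂ).re ≤ E * (⟪x, x⟫_ℂ).re := by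
  have h : T ≤ algebraMap ℝ (F →L[ℂ] F) E :=
    (le_algebraMap_iff_spectrum_le hT).2
      fun r hr => hE r ((spectrum.algebraMap_mem_iff ℂ).2 hr)
  have h2 := ((ContinuousLinearMap.le_def _ _).1 h).re_inner_nonneg_left x
  have h3 : (algebraMap ℝ (F →L[ℂ] F) E - T) x = (E : ℂ) • x - T x := by
    simp [Algebra.algebraMap_eq_smul_one]
  rw [h3, inner_sub_left, inner_smul_left, Complex.conj_ofReal] at h2
  simpa only [RCLike.re_eq_complex_re, Complex.sub_re, Complex.re_ofReal_mul, sub_nonneg] using h2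

namespace Schrodinger

/-! ### Self-adjointness and the quadratic form -/

theorem inner_shift_left (k : ℤ) (x y : EllTwo) :
    ⟪shift k x, y⟫_ℂ = ⟪x, shift (-k) y⟫_ℂ := by
  rw [lp.inner_eq_tsum, lp.inner_eq_tsum,
    ← (Equiv.addRight k).tsum_eq (fun n => ⟪x n, shift (-k) y n⟫_ℂ)]
  refine tsum_congr fun n => ?_
  change ⟪x (n + k), y n⟫_ℂ = ⟪x (n + k), y (n + k + -k)⟫_ℂ
  rw [add_neg_cancel_right]

theorem inner_potential_left (V : ℤ → ℝ) (hV : ∃ C : ℝ, ∀ n, |V n| ≤ C) (x y : EllTwo) :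
    ⟪potential V hV x, y⟫_ℂ = ⟪x, potential V hV y⟫_ℂ := by
  rw [lp.inner_eq_tsum, lp.inner_eq_tsum]
  refine tsum_congr fun n => ?_
  change ⟪(V n : ℂ) * x n, y n⟫_ℂ = ⟪x n, (V n : ℂ) * y n⟫_ℂ
  simp only [RCLike.inner_apply, map_mul, Complex.conj_ofReal]
  ring

theorem inner_hamiltonian_left (V : ℤ → ℝ) (hV : ∃ C : ℝ, ∀ n, |V n| ≤ C) (x y : EllTwo) :
    ⟪hamiltonian V hV x, y⟫_ℂ = ⟪x, hamiltonian V hV y⟫_ℂ := by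
  simp only [hamiltonian, add_apply, inner_add_left, inner_add_right,
    inner_shift_left, inner_potential_left, neg_neg]
  ring

theorem isSelfAdjoint_hamiltonian (V : ℤ → ℝ) (hV : ∃ C : ℝ, ∀ n, |V n| ≤ C) :
    IsSelfAdjoint (hamiltonian V hV) :=
  ContinuousLinearMap.isSelfAdjoint_iff_isSymmetric.2 fun x y => inner_hamiltonian_left V hV x y

/-- The quadratic form of `E - H`. -/
noncomputable def energyForm (V : ℤ → ℝ) (hV : ∃ C : ℝ, ∀ n, |V n| ≤ C) (E : ℝ) (x : EllTwo) : ℝ :=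
  E * (⟪x, x⟫_ℂ).re - (⟪hamiltonian V hV x, x⟫_ℂ).re

theorem energyForm_nonneg {V : ℤ → ℝ} {hV : ∃ C : ℝ, ∀ n, |V n| ≤ C} {E : ℝ}
    (hE : IsGroundStateEnergy V hV E) (x : EllTwo) : 0 ≤ energyForm V hV E x :=
  sub_nonneg.2 ((isSelfAdjoint_hamiltonian V hV).re_inner_le_of_spectrum_le
    (fun _ hr => hE.2 hr) x)

theorem energyForm_add_single (V : ℤ → ℝ) (hV : ∃ C : ℝ, ∀ n, |V n| ≤ C) (E : ℝ) (ψ : EllTwo)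
    (m : ℤ) (x : ℝ) :
    energyForm V hV E (ψ + lp.single 2 m (x : ℂ)) = energyForm V hV E ψ
      + 2 * x * (E * (ψ m).re - (hamiltonian V hV ψ m).re) + x ^ 2 * (E - V m) := by
  have h1 : hamiltonian V hV (lp.single 2 m (x : ℂ)) m = V m * x := by
    simp [hamiltonian_apply]
  simp only [energyForm, map_add, inner_add_left, inner_add_right,
    inner_hamiltonian_left V hV (lp.single 2 m (x : ℂ)), lp.inner_single_left,
    lp.inner_single_right, h1, RCLike.inner_apply, Complex.add_re, Complex.mul_re]
  simp
  ring

/-! ### Positivity of Dirichlet solutions -/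

/-- The solution of `s (k + 2) + s k = b (k + 1) * s (k + 1)` with `s 0 = 0`, `s 1 = 1`. -/
noncomputable def dirichletSolution (b : ℕ → ℝ) : ℕ → ℝ
  | 0 => 0
  | 1 => 1
  | k + 2 => b (k + 1) * dirichletSolution b (k + 1) - dirichletSolution b k

/-- The witness is `s` cut off to `(M, M + K]`: on its support, `(E - H) ψ` vanishes except at the
last site, where it equals `s (K + 1)`. -/
theorem exists_truncation (V : ℤ → ℝ) (hV : ∃ C : ℝ, ∀ n, |V n| ≤ C) (E : ℝ) (M : ℤ) (K : ℕ) :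
    ∃ ψ : EllTwo, ψ (M + K) = dirichletSolution (fun k => E - V (M + k)) K ∧
      (∀ n, M + K < n → ψ n = 0) ∧
      energyForm V hV E ψ = dirichletSolution (fun k => E - V (M + k)) K *
        dirichletSolution (fun k => E - V (M + k)) (K + 1) := by
  set s := dirichletSolution (fun k => E - V (M + k)) with hs
  induction K with
  | zero => exact ⟨0, by simp [hs, dirichletSolution, energyForm]⟩
  | succ K ih =>
    obtain ⟨ψ, h1, h2, h3⟩ := ih
    refine ⟨ψ + lp.single 2 (M + (K + 1 : ℕ)) (s (K + 1) : ℂ), ?_, fun n hn => ?_, ?_⟩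
    · simp [h2 (M + (K + 1)) (by omega)]
    · push_cast at hn
      have h : n ≠ M + (K + 1) := by omega
      simp [h2 n (by omega), h]
    · have hm := h2 (M + (K + 1 : ℕ)) (by push_cast; omega)
      have hm1 := h2 (M + (K + 1 : ℕ) + 1) (by push_cast; omega)
      have hm2 : M + (K + 1 : ℕ) - 1 = M + K := by push_cast; ring
      have hrec : s (K + 2) = (E - V (M + (K + 1 : ℕ))) * s (K + 1) - s K := rfl
      rw [energyForm_add_single, h3, hamiltonian_apply, hm, hm1, hm2, h1, hrec]
      simp
      ring

/-- At a first failure of positivity the truncation has form `≤ 0`; a small mass `ε` at the next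
site changes it by `-2 ε s (K + 1) + O(ε ^ 2)`, making it negative. -/
theorem dirichletSolution_pos {V : ℤ → ℝ} {hV : ∃ C : ℝ, ∀ n, |V n| ≤ C} {E : ℝ}
    (hE : IsGroundStateEnergy V hV E) (M : ℤ) (K : ℕ) :
    0 < dirichletSolution (fun k => E - V (M + k)) (K + 1) := by
  induction K with
  | zero => exact one_pos
  | succ K ih =>
    by_contra! hneg
    obtain ⟨ψ, h1, h2, h3⟩ := exists_truncation V hV E M (K + 1)
    set s := dirichletSolution (fun k => E - V (M + k)) with hs
    have hm := h2 (M + (K + 2 : ℕ)) (by push_cast; omega)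
    have hm1 := h2 (M + (K + 2 : ℕ) + 1) (by push_cast; omega)
    have hm2 : M + (K + 2 : ℕ) - 1 = M + (K + 1 : ℕ) := by push_cast; ring
    have key (ε : ℝ) : 0 ≤ s (K + 1) * s (K + 2) - 2 * ε * s (K + 1)
        + ε ^ 2 * (E - V (M + (K + 2 : ℕ))) := by
      have h := energyForm_nonneg hE (ψ + lp.single 2 (M + (K + 2 : ℕ)) (ε : ℂ))
      rw [energyForm_add_single, h3, hamiltonian_apply, hm, hm1, hm2, h1] at h
      simp only [Complex.zero_re, Complex.ofReal_re, mul_zero, zero_add,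
        add_zero, zero_sub] at h
      linarith
    -- `A` is a positive bound for the coefficient of `ε ^ 2`, and `s (K + 1) / A` minimizes the
    -- resulting upper bound.
    set A := |E - V (M + (K + 2 : ℕ))| + 1
    have hA : 0 < A := by positivity
    have hle : E - V (M + (K + 2 : ℕ)) ≤ A := (le_abs_self _).trans (by simp [A])
    have hε := key (s (K + 1) / A)
    have h4 : (s (K + 1) / A) ^ 2 * (E - V (M + (K + 2 : ℕ))) ≤ s (K + 1) ^ 2 / A := by
      refine (mul_le_mul_of_nonneg_left hle (sq_nonneg _)).trans_eq ?_
      field_simp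
    have h5 : 2 * (s (K + 1) / A) * s (K + 1) = 2 * (s (K + 1) ^ 2 / A) := by ring
    have h6 : 0 < s (K + 1) ^ 2 / A := by positivity
    have h7 : s (K + 1) * s (K + 2) ≤ 0 := mul_nonpos_of_nonneg_of_nonpos ih.le hneg
    linarith

/-! ### A positive solution by compactness -/

/-- A solution of the difference equation on `(-(j + 1), ∞)`, vanishing on `(-∞, -(j + 1)]` and
equal to `1` at `0`. -/
noncomputable def normalizedSolution (V : ℤ → ℝ) (E : ℝ) (j : ℕ) (n : ℤ) : ℝ :=
  dirichletSolution (fun k => E - V (-(j + 1 : ℤ) + k)) (n + (j + 1)).toNat /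
    dirichletSolution (fun k => E - V (-(j + 1 : ℤ) + k)) (j + 1)

variable {V : ℤ → ℝ} {hV : ∃ C : ℝ, ∀ n, |V n| ≤ C} {E : ℝ}

theorem normalizedSolution_zero (hE : IsGroundStateEnergy V hV E) (j : ℕ) :
    normalizedSolution V E j 0 = 1 := by
  have h : ((0 : ℤ) + (j + 1)).toNat = j + 1 := by omega
  rw [normalizedSolution, h, div_self (dirichletSolution_pos hE _ j).ne']

theorem normalizedSolution_of_le {j : ℕ} {n : ℤ} (hn : n ≤ -(j + 1 : ℤ)) :
    normalizedSolution V E j n = 0 := by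
  have h : (n + (j + 1)).toNat = 0 := by omega
  rw [normalizedSolution, h]
  simp [dirichletSolution]

theorem normalizedSolution_nonneg (hE : IsGroundStateEnergy V hV E) (j : ℕ) (n : ℤ) :
    0 ≤ normalizedSolution V E j n := by
  rcases le_or_gt n (-(j + 1 : ℤ)) with hn | hn
  · rw [normalizedSolution_of_le hn]
  · obtain ⟨k, hk⟩ : ∃ k, (n + (j + 1)).toNat = k + 1 := ⟨(n + j).toNat, by omega⟩
    rw [normalizedSolution, hk]
    exact div_nonneg (dirichletSolution_pos hE _ k).le (dirichletSolution_pos hE _ j).le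

theorem normalizedSolution_rec {j : ℕ} {n : ℤ} (hn : -(j + 1 : ℤ) < n) :
    normalizedSolution V E j (n + 1) + normalizedSolution V E j (n - 1) =
      (E - V n) * normalizedSolution V E j n := by
  obtain ⟨k, rfl⟩ : ∃ k : ℕ, n = -(j + 1 : ℤ) + (k + 1 : ℕ) := ⟨(n + j).toNat, by omega⟩
  have h0 : (-(j + 1 : ℤ) + (k + 1 : ℕ) - 1 + (j + 1)).toNat = k := by omega
  have h1 : (-(j + 1 : ℤ) + (k + 1 : ℕ) + (j + 1)).toNat = k + 1 := by omega
  have h2 : (-(j + 1 : ℤ) + (k + 1 : ℕ) + 1 + (j + 1)).toNat = k + 2 := by omega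
  simp only [normalizedSolution, h0, h1, h2, dirichletSolution]
  ring

/-- A Harnack-type bound: both neighbours are nonnegative, so each is at most `|E - V n|` times the
value at `n`. -/
theorem exists_bound_normalizedSolution (hE : IsGroundStateEnergy V hV E) (n : ℤ) :
    ∃ B : ℝ, ∀ j, normalizedSolution V E j n ≤ B := by
  induction n with
  | zero => exact ⟨1, fun j => (normalizedSolution_zero hE j).le⟩
  | succ k ih =>
    obtain ⟨B, hB⟩ := ih
    refine ⟨|E - V k| * B, fun j => ?_⟩
    have h1 := normalizedSolution_rec (V := V) (E := E) (j := j) (n := k) (by omega)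
    have h2 := normalizedSolution_nonneg hE j (k - 1)
    have h3 := normalizedSolution_nonneg hE j k
    calc _ ≤ (E - V k) * normalizedSolution V E j k := by linarith
      _ ≤ |E - V k| * B := mul_le_mul (le_abs_self _) (hB j) h3 (abs_nonneg _)
  | pred k ih =>
    obtain ⟨B, hB⟩ := ih
    refine ⟨|E - V (-k)| * B, fun j => ?_⟩
    have h3 := normalizedSolution_nonneg hE j (-k)
    rcases le_or_gt (-k : ℤ) (-(j + 1 : ℤ)) with hk | hk
    · rw [normalizedSolution_of_le (by omega)]
      exact mul_nonneg (abs_nonneg _) (h3.trans (hB j))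
    · have h1 := normalizedSolution_rec (V := V) (E := E) hk
      have h2 := normalizedSolution_nonneg hE j (-k + 1)
      calc _ ≤ (E - V (-k)) * normalizedSolution V E j (-k) := by linarith
        _ ≤ |E - V (-k)| * B := mul_le_mul (le_abs_self _) (hB j) h3 (abs_nonneg _)

theorem pos_of_nonneg_of_rec {a p : ℤ → ℝ} (hp : ∀ n, 0 ≤ p n) (hp0 : p 0 ≠ 0)
    (h : ∀ n, p (n + 1) + p (n - 1) = a n * p n) (n : ℤ) : 0 < p n := by
  have key (n : ℤ) (hn : p n = 0) : p (n + 1) = 0 ∧ p (n - 1) = 0 := by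
    have h1 := h n
    rw [hn, mul_zero] at h1
    constructor <;> linarith [hp (n + 1), hp (n - 1)]
  refine (hp n).lt_of_ne' ?_
  induction n with
  | zero => exact hp0
  | succ k ih => exact fun hk => ih (by simpa using (key _ hk).2)
  | pred k ih => exact fun hk => ih (by simpa using (key _ hk).1)

theorem exists_pos_solution (hE : IsGroundStateEnergy V hV E) :
    ∃ p : ℤ → ℝ, (∀ n, 0 < p n) ∧ IsSolution V E fun n => (p n : ℂ) := by
  choose B hB using exists_bound_normalizedSolution hE
  have hmem (j : ℕ) : normalizedSolution V E j ∈ Set.univ.pi fun n => Set.Icc 0 (B n) :=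
    fun n _ => ⟨normalizedSolution_nonneg hE j n, hB n j⟩
  obtain ⟨p, hp, φ, hφ, hlim⟩ :=
    (isCompact_univ_pi fun n => isCompact_Icc (a := 0) (b := B n)).tendsto_subseq hmem
  have hlim' (n : ℤ) := tendsto_pi_nhds.1 hlim n
  have hrec (n : ℤ) : p (n + 1) + p (n - 1) = (E - V n) * p n := by
    refine tendsto_nhds_unique_of_eventuallyEq ((hlim' (n + 1)).add (hlim' (n - 1)))
      ((hlim' n).const_mul _) ?_
    filter_upwards [hφ.tendsto_atTop.eventually_ge_atTop n.natAbs] with j hj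
    exact normalizedSolution_rec (by omega)
  have hp0 : p 0 = 1 := tendsto_nhds_unique (hlim' 0)
    (tendsto_const_nhds.congr fun j => (normalizedSolution_zero hE (φ j)).symm)
  refine ⟨p, pos_of_nonneg_of_rec (fun n => (hp n trivial).1) (by simp [hp0]) hrec, fun n => ?_⟩
  have h : p (n + 1) + p (n - 1) + V n * p n = E * p n := by linear_combination hrec n
  simpa using congrArg (Complex.ofReal) h

/-! ### Subordinacy against a positive solution -/

theorem not_tendsto_sum_sq_div_of_eventually_le {a p : ℤ → ℝ} (hp : ∀ n, 0 < p n) {δ : ℝ}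
    (hδ : 0 < δ) {m : ℤ} (h : ∀ n ≥ m, δ * p n ≤ a n) :
    ¬ Tendsto (fun N : ℕ => (∑ n ∈ Finset.Icc 1 N, a (n : ℤ) ^ 2) /
        (∑ n ∈ Finset.Icc 1 N, p (n : ℤ) ^ 2)) atTop (𝓝 0) := by
  intro hlim
  set k := m.toNat
  set P : ℕ → ℝ := fun N => ∑ n ∈ Finset.Icc 1 N, p (n : ℤ) ^ 2 with hP
  set U : ℕ → ℝ := fun N => ∑ n ∈ Finset.Icc 1 N, a (n : ℤ) ^ 2 with hU
  have hPs (N : ℕ) : P (N + 1) = P N + p ((N + 1 : ℕ) : ℤ) ^ 2 :=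
    Finset.sum_Icc_succ_top (by omega) _
  have hUs (N : ℕ) : U (N + 1) = U N + a ((N + 1 : ℕ) : ℤ) ^ 2 :=
    Finset.sum_Icc_succ_top (by omega) _
  have hP0 (N : ℕ) : 0 ≤ P N := Finset.sum_nonneg fun _ _ => sq_nonneg _
  set t := p ((k + 1 : ℕ) : ℤ) ^ 2 with ht
  have ht0 : 0 < t := pow_pos (hp _) 2
  have hT : ∀ N ≥ k + 1, P k + t ≤ P N := by
    intro N hN
    rw [ht, ← hPs]
    exact monotone_nat_of_le_succ (fun N => by rw [hPs]; exact le_add_of_nonneg_right (sq_nonneg _)) hN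
  have hUP : ∀ N ≥ k, δ ^ 2 * (P N - P k) ≤ U N := by
    intro N hN
    induction N, hN using Nat.le_induction with
    | base => simpa using Finset.sum_nonneg fun _ _ => sq_nonneg _
    | succ N hN ih =>
      have h1 := h ((N + 1 : ℕ) : ℤ) (by omega)
      have h2 := pow_le_pow_left₀ (mul_pos hδ (hp _)).le h1 2
      rw [hPs, hUs]
      rw [mul_pow] at h2
      linarith
  -- `(P N - P k) / P N` increases with `P N`, so its value at `P k + t` is a lower bound, whether
  -- or not `P` diverges.
  have hlow : ∀ᶠ N in atTop, δ ^ 2 * t / (P k + t) ≤ U N / P N := by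
    filter_upwards [eventually_ge_atTop (k + 1)] with N hN
    have h1 := hT N hN
    have h2 := hUP N (by omega)
    have h3 := hP0 k
    rw [div_le_div_iff₀ (by linarith) (by linarith)]
    calc δ ^ 2 * t * P N ≤ δ ^ 2 * ((P N - P k) * (P k + t)) := by
          rw [mul_assoc]
          refine mul_le_mul_of_nonneg_left ?_ (sq_nonneg δ)
          nlinarith
      _ = δ ^ 2 * (P N - P k) * (P k + t) := by ring
      _ ≤ U N * (P k + t) := by gcongr
  have := ge_of_tendsto hlim hlow
  have h4 : 0 < δ ^ 2 * t / (P k + t) := div_pos (by positivity) (by linarith [hP0 k])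
  linarith

theorem eq_zero_of_succ_eq {α : Type*} {F : ℤ → α} (h : ∀ n, F (n + 1) = F n) (n : ℤ) :
    F n = F 0 := by
  induction n with
  | zero => rfl
  | succ k ih => rw [h, ih]
  | pred k ih => rw [← h, sub_add_cancel, ih]

theorem IsSubordinateAtTop.positiveUpToConstant {V : ℤ → ℝ} {E : ℝ} {p : ℤ → ℝ}
    (hp : ∀ n, 0 < p n) (hsol : IsSolution V E fun n => (p n : ℂ)) {u : ℤ → ℂ}
    (hu : IsSubordinateAtTop V E u) : PositiveUpToConstant u := by
  obtain ⟨hus, hu0, hsub⟩ := hu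
  have hpc (n : ℤ) : (p n : ℂ) ≠ 0 := by exact_mod_cast (hp n).ne'
  by_cases hc : ∃ c : ℂ, (fun n => (p n : ℂ)) = c • u
  · obtain ⟨c, hc⟩ := hc
    refine ⟨c, ?_, fun n => ⟨p n, hp n, (congrFun hc n).symm⟩⟩
    rintro rfl
    exact hpc 0 (by simpa using congrFun hc 0)
  have hlim := hsub _ hsol hc
  simp only [Complex.norm_real, Real.norm_eq_abs, sq_abs] at hlim
  have hno (δ : ℝ) (hδ : 0 < δ) (m : ℤ) (h : ∀ n ≥ m, δ * p n ≤ ‖u n‖) : False :=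
    not_tendsto_sum_sq_div_of_eventually_le hp hδ h hlim
  set W : ℂ := u 1 * p 0 - u 0 * p 1 with hW
  have hwr (n : ℤ) : u (n + 1) * p n - u n * p (n + 1) = W := by
    refine (eq_zero_of_succ_eq (F := fun n => u (n + 1) * p n - u n * p (n + 1)) ?_ n).trans
      (by simp [hW])
    intro n
    have h1 := hus (n + 1)
    have h2 := hsol (n + 1)
    simp only [add_sub_cancel_right] at h1 h2
    linear_combination (p (n + 1) : ℂ) * h1 - u (n + 1) * h2
  have hW0 : W ≠ 0 := by
    intro h0
    have hf (n : ℤ) : u n / p n = u 0 / p 0 := by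
      refine eq_zero_of_succ_eq (F := fun n => u n / p n) (fun n => ?_) n
      rw [div_eq_div_iff (hpc _) (hpc _)]
      linear_combination hwr n + h0
    have hd : u 0 / p 0 ≠ 0 := by
      intro hd
      refine hu0 (funext fun n => ?_)
      have := hf n
      rw [hd, div_eq_zero_iff] at this
      exact this.resolve_right (hpc n)
    refine hc ⟨(u 0 / p 0)⁻¹, funext fun n => ?_⟩
    have h := (div_eq_iff (hpc n)).1 (hf n)
    simp only [Pi.smul_apply, smul_eq_mul]
    rw [h, inv_mul_cancel_left₀ hd]
  set g : ℤ → ℂ := fun n => u n / (W * p n) with hg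
  have hug (n : ℤ) : u n = W * g n * p n := by
    have := hpc n
    simp only [hg]
    field_simp
  have hstep (n : ℤ) : g (n + 1) = g n + ((p n * p (n + 1))⁻¹ : ℝ) := by
    have h1 := hpc n
    have h2 := hpc (n + 1)
    simp only [hg]
    push_cast
    field_simp
    linear_combination hwr n
  have hnorm (n : ℤ) : ‖u n‖ = ‖W‖ * ‖g n‖ * p n := by
    rw [hug n, norm_mul, norm_mul, Complex.norm_real, Real.norm_of_nonneg (hp n).le]
  have hg_low (δ : ℝ) (hδ : 0 < δ) (m : ℤ) (h : ∀ n ≥ m, δ ≤ ‖g n‖) : False := by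
    refine hno (‖W‖ * δ) (mul_pos (norm_pos_iff.2 hW0) hδ) m fun n hn => ?_
    rw [hnorm]
    have := h n hn
    have := (hp n).le
    gcongr
  have him (n : ℤ) : (g n).im = 0 := by
    have hconst : ∀ n, (g n).im = (g 0).im :=
      eq_zero_of_succ_eq (F := fun n => (g n).im) fun n => by
        simp [hstep n, -Complex.ofReal_inv, -Complex.ofReal_mul]
    by_contra hne
    exact hg_low |(g n).im| (abs_pos.2 hne) 0 fun k _ => by
      rw [hconst n, ← hconst k]
      exact Complex.abs_im_le_norm _
  have hmono : StrictMono fun n => (g n).re := strictMono_int_of_lt_succ fun n => by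
    have := hp n
    have := hp (n + 1)
    rw [hstep n, Complex.add_re, Complex.ofReal_re]
    exact lt_add_of_pos_right _ (by positivity)
  have hneg (n : ℤ) : (g n).re < 0 := by
    by_contra! hn
    -- `g n` may be `0`; one step further the real part is strictly positive.
    exact hg_low (g (n + 1)).re (hn.trans_lt (hmono (lt_add_one n))) (n + 1) fun k hk =>
      (hmono.monotone hk).trans (Complex.re_le_norm _)
  refine ⟨-W⁻¹, neg_ne_zero.2 (inv_ne_zero hW0), fun n =>
    ⟨-(g n).re * p n, mul_pos (neg_pos.2 (hneg n)) (hp n), ?_⟩⟩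
  have hgr : g n = ((g n).re : ℂ) := Complex.ext rfl (him n)
  rw [hug n]
  push_cast
  rw [← hgr]
  field_simp

theorem IsSolution.reflect {V : ℤ → ℝ} {E : ℝ} {u : ℤ → ℂ} (hu : IsSolution V E u) :
    IsSolution (fun n => V (-n)) E fun n => u (-n) := fun n => by
  change u (-(n + 1)) + u (-(n - 1)) + V (-n) * u (-n) = E * u (-n)
  rw [← hu (-n), neg_add', neg_sub, sub_eq_neg_add 1 n, add_comm (u (-n - 1))]

theorem IsSubordinateAtBot.reflect {V : ℤ → ℝ} {E : ℝ} {u : ℤ → ℂ}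
    (hu : IsSubordinateAtBot V E u) :
    IsSubordinateAtTop (fun n => V (-n)) E fun n => u (-n) := by
  refine ⟨hu.1.reflect, fun h => hu.2.1 (funext fun n => by simpa using congrFun h (-n)),
    fun v hv hvu => ?_⟩
  have := hu.2.2 (fun n => v (-n)) (by simpa using hv.reflect) ?_
  · simpa using this
  · rintro ⟨c, hc⟩
    exact hvu ⟨c, funext fun n => by simpa using congrFun hc (-n)⟩

theorem PositiveUpToConstant.of_reflect {u : ℤ → ℂ}
    (hu : PositiveUpToConstant fun n => u (-n)) : PositiveUpToConstant u := by
  obtain ⟨c, hc, h⟩ := hu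
  exact ⟨c, hc, fun n => by simpa using h (-n)⟩

end Schrodinger

theorem theoremt (V : ℤ → ℝ) (hV : ∃ C : ℝ, ∀ n, |V n| ≤ C) (E : ℝ)
    (hE : Schrodinger.IsGroundStateEnergy V hV E) :
    (∀ u : ℤ → ℂ, Schrodinger.IsSubordinateAtTop V E u → Schrodinger.PositiveUpToConstant u) ∧
    (∀ u : ℤ → ℂ, Schrodinger.IsSubordinateAtBot V E u →
      Schrodinger.PositiveUpToConstant u) := by
  obtain ⟨p, hp, hsol⟩ := Schrodinger.exists_pos_solution hE
  refine ⟨fun u hu => hu.positiveUpToConstant hp hsol, fun u hu => ?_⟩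
  exact .of_reflect (hu.reflect.positiveUpToConstant (fun n => hp (-n)) hsol.reflect)
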